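/- For real $a,b,c$ put $\Pi(a,b,c)=[0,a]\times[0,b]\times[0,c]\subset\mathbb{R}^3$. The Jankins--Neumann ziggurat $\tilde{\mathcal Z}$ is the union, over all coprime integers $0<a<m$, of the boxes $\Pi\left(\frac am,\frac{m-a}m,\frac1m\right)$ and of their images under all permutations of the coordinates, that is, $$\tilde{\mathcal Z}=\bigcup_{\substack{0<a<m\\ \gcd(a,m)=1}}\Pi\left(\tfrac am,\tfrac{m-a}m,\tfrac1m\right)\cup\Pi\left(\tfrac am,\tfrac1m,\tfrac{m-a}m\right)\cup\Pi\left(\tfrac1m,\tfrac am,\tfrac{m-a}m\right).$$ A point $X$ is a vertex of $\tilde{\mathcal Z}$ if $X\in\tilde{\mathcal Z}$ and there is no $\Pi(a,b,c)\subset\tilde{\mathcal Z}$ with $X\in\Pi(a,b,c)\setminus\{(a,b,c)\}$. The set of vertices of $\tilde{\mathcal Z}$ is exactly the union of the following three families, which are obtained from one another by permutations of the coordinates: 1. $\left(\frac am,\frac{m-a}m,\frac1m\right)$ with coprime $0<a<m$; 2. $\left(\frac{m-a}m,\frac1m,\frac am\right)$ with coprime $0<a<m$; 3. $\left(\frac1m,\frac{m-a}m,\frac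 am\right)$ with coprime $0<a<m$. These three families lie respectively on the planes $x+y=1$, $x+z=1$ and $y+z=1$. Moreover, they lie respectively in the (closed) triangles $ABD$, $ACD$ and $BCD$, where $A=(1,0,0)$, $B=(0,1,0)$, $C=(0,0,1)$ and $D=(\frac12,\frac12,\frac12)$, and $D$ is the only point common to all three families. -/

import Mathlib

noncomputable section

namespace JankinsNeumann

/-- The parallelepiped `Π(a, b, c) = [0, a] × [0, b] × [0, c]` in three-dimensional space. -/
def box (a b c : ℝ) : Set (ℝ × ℝ × ℝ) :=
  {X | X.1 ∈ Set.Icc 0 a ∧ X.2.1 ∈ Set.Icc 0 b ∧ X.2.2 ∈ Set.Icc 0 c}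

/-- The Jankins–Neumann ziggurat: the union, over all coprime `0 < a < m`, of the box
`Π(a/m, (m-a)/m, 1/m)` and its images under the permutations of the coordinates.
(Replacing `a` by `m - a` exchanges the first two side lengths, so the three positions of the
side `1/m` account for all six permutations.) -/
def ziggurat : Set (ℝ × ℝ × ℝ) :=
  {X | ∃ a m : ℕ, 0 < a ∧ a < m ∧ a.Coprime m ∧
    (X ∈ box ((a : ℝ) / m) (((m : ℝ) - a) / m) (1 / (m : ℝ)) ∨
      X ∈ box ((a : ℝ) / m) (1 / (m : ℝ)) (((m : ℝ) - a) / m) ∨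
      X ∈ box (1 / (m : ℝ)) ((a : ℝ) / m) (((m : ℝ) - a) / m))}

/-- `X` is a vertex of `Z` if `X ∈ Z` and no box contained in `Z` contains `X` except as its
extreme corner. -/
def IsVertex (Z : Set (ℝ × ℝ × ℝ)) (X : ℝ × ℝ × ℝ) : Prop :=
  X ∈ Z ∧ ¬ ∃ a b c : ℝ, box a b c ⊆ Z ∧ X ∈ box a b c \ {(a, b, c)}

/-- The points `(a/m, (m-a)/m, 1/m)` with coprime `0 < a < m`. -/
def family₁ : Set (ℝ × ℝ × ℝ) :=
  {X | ∃ a m : ℕ, 0 < a ∧ a < m ∧ a.Coprime m ∧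
    X = ((a : ℝ) / m, ((m : ℝ) - a) / m, 1 / (m : ℝ))}

/-- The points `((m-a)/m, 1/m, a/m)` with coprime `0 < a < m`. -/
def family₂ : Set (ℝ × ℝ × ℝ) :=
  {X | ∃ a m : ℕ, 0 < a ∧ a < m ∧ a.Coprime m ∧
    X = (((m : ℝ) - a) / m, 1 / (m : ℝ), (a : ℝ) / m)}

/-- The points `(1/m, (m-a)/m, a/m)` with coprime `0 < a < m`. -/
def family₃ : Set (ℝ × ℝ × ℝ) :=
  {X | ∃ a m : ℕ, 0 < a ∧ a < m ∧ a.Coprime m ∧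
    X = (1 / (m : ℝ), ((m : ℝ) - a) / m, (a : ℝ) / m)}

/-- The point at unit distance on the axis `Ox`. -/
def ptA : ℝ × ℝ × ℝ := (1, 0, 0)

/-- The point at unit distance on the axis `Oy`. -/
def ptB : ℝ × ℝ × ℝ := (0, 1, 0)

/-- The point at unit distance on the axis `Oz`. -/
def ptC : ℝ × ℝ × ℝ := (0, 0, 1)

/-- The point `(1/2, 1/2, 1/2)`. -/
def ptD : ℝ × ℝ × ℝ := (1 / 2, 1 / 2, 1 / 2)

/-- The (closed) triangle with vertices `P`, `Q`, `R`. -/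
def triangle (P Q R : ℝ × ℝ × ℝ) : Set (ℝ × ℝ × ℝ) := convexHull ℝ {P, Q, R}

end JankinsNeumann

end

namespace JankinsNeumann

/-! The ziggurat is a union of order intervals `Set.Icc 0 Y` with `Y` in the three families, so its
vertices are exactly these corners once the corners form an antichain (`setOf_isVertex_eq`). With `q
= m - a`, a corner has coordinates `p/(p+q)`, `q/(p+q)`, `1/(p+q)` in some order, and the first two
sum to 1. Within one family, domination therefore forces equal ratios, and coprimality makes the
corners equal. Across families it forces a numerator to be 1, where the two corners coincide
(`corner_eq_of_le`). -/

theorem box_eq_Icc (a b c : ℝ) : box a b c = Set.Icc 0 (a, b, c) := by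
  ext ⟨x, y, z⟩
  simp only [box, Set.mem_ofPred_eq, Set.mem_Icc, Prod.le_def, Prod.fst_zero, Prod.snd_zero]
  tauto

/-- A union of boxes whose extreme corners are nonnegative and pairwise incomparable has exactly
these corners as its vertices. -/
theorem setOf_isVertex_eq {Z S : Set (ℝ × ℝ × ℝ)}
    (hZ : ∀ X, X ∈ Z ↔ ∃ Y ∈ S, X ∈ Set.Icc 0 Y)
    (hpos : ∀ X ∈ S, 0 ≤ X) (hS : ∀ X ∈ S, ∀ Y ∈ S, X ≤ Y → X = Y) :
    {X | IsVertex Z X} = S := by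
  ext X
  constructor
  · rintro ⟨hX, hv⟩
    obtain ⟨Y, hY, hXY⟩ := (hZ X).1 hX
    by_contra hXS
    refine hv ⟨Y.1, Y.2.1, Y.2.2, ?_, ?_, ?_⟩
    · rw [box_eq_Icc]
      exact fun W hW => (hZ W).2 ⟨Y, hY, hW⟩
    · rw [box_eq_Icc]
      exact hXY
    · rintro rfl
      exact hXS hY
  · intro hX
    refine ⟨(hZ X).2 ⟨X, hX, hpos X hX, le_rfl⟩, ?_⟩
    rintro ⟨a, b, c, hsub, hmem, hne⟩
    rw [box_eq_Icc] at hsub hmem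
    -- The extreme corner of the box lies in `Z`, hence below some `Y` in `S`; the antichain
    -- condition squeezes it between `X` and `Y = X`.
    obtain ⟨Y, hY, -, hle⟩ := (hZ _).1 (hsub ⟨hmem.1.trans hmem.2, le_rfl⟩)
    have hXY := hS X hX Y hY (hmem.2.trans hle)
    exact hne (le_antisymm hmem.2 (hXY ▸ hle))

/-! ### Symmetric parametrization of the corners -/

/-- The substitution `m = p + q` makes the two large coordinates interchangeable. The predicate `P`
lets one proof serve the ziggurat and all three families. -/
theorem exists_coprime_lt_iff {P : ℝ → ℝ → ℝ → Prop} :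
    (∃ a m : ℕ, 0 < a ∧ a < m ∧ a.Coprime m ∧ P ((a : ℝ) / m) (((m : ℝ) - a) / m) (1 / (m : ℝ))) ↔
      ∃ p q : ℕ, 0 < p ∧ 0 < q ∧ p.Coprime q ∧
        P ((p : ℝ) / (p + q)) ((q : ℝ) / (p + q)) (1 / ((p : ℝ) + q)) := by
  constructor
  · rintro ⟨a, m, ha, ham, hc, h⟩
    obtain ⟨q, rfl⟩ := Nat.exists_eq_add_of_lt ham
    refine ⟨a, q + 1, ha, q.succ_pos, ?_, ?_⟩
    · simpa [add_assoc] using hc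
    · push_cast at h ⊢
      convert h using 2 <;> ring
  · rintro ⟨p, q, hp, hq, hc, h⟩
    refine ⟨p, p + q, hp, by omega, by simpa using hc, ?_⟩
    push_cast
    simpa using h

theorem exists_coprime_swap {P : ℕ → ℕ → Prop} :
    (∃ p q : ℕ, 0 < p ∧ 0 < q ∧ p.Coprime q ∧ P p q) ↔
      ∃ p q : ℕ, 0 < p ∧ 0 < q ∧ p.Coprime q ∧ P q p :=
  ⟨fun ⟨p, q, hp, hq, hc, h⟩ => ⟨q, p, hq, hp, hc.symm, h⟩,
    fun ⟨p, q, hp, hq, hc, h⟩ => ⟨q, p, hq, hp, hc.symm, h⟩⟩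

theorem mem_family₁_iff {X : ℝ × ℝ × ℝ} : X ∈ family₁ ↔
    ∃ p q : ℕ, 0 < p ∧ 0 < q ∧ p.Coprime q ∧
      X = ((p : ℝ) / (p + q), (q : ℝ) / (p + q), 1 / ((p : ℝ) + q)) :=
  exists_coprime_lt_iff (P := fun x y z => X = (x, y, z))

theorem mem_family₂_iff {X : ℝ × ℝ × ℝ} : X ∈ family₂ ↔
    ∃ p q : ℕ, 0 < p ∧ 0 < q ∧ p.Coprime q ∧
      X = ((p : ℝ) / (p + q), 1 / ((p : ℝ) + q), (q : ℝ) / (p + q)) := by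
  refine (exists_coprime_lt_iff (P := fun x y z => X = (y, z, x))).trans ?_
  rw [exists_coprime_swap]
  simp only [add_comm]

theorem mem_family₃_iff {X : ℝ × ℝ × ℝ} : X ∈ family₃ ↔
    ∃ p q : ℕ, 0 < p ∧ 0 < q ∧ p.Coprime q ∧
      X = (1 / ((p : ℝ) + q), (p : ℝ) / (p + q), (q : ℝ) / (p + q)) := by
  refine (exists_coprime_lt_iff (P := fun x y z => X = (z, y, x))).trans ?_
  rw [exists_coprime_swap]
  simp only [add_comm]

theorem mem_ziggurat_iff (X : ℝ × ℝ × ℝ) :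
    X ∈ ziggurat ↔ ∃ Y ∈ family₁ ∪ family₂ ∪ family₃, X ∈ Set.Icc 0 Y := by
  refine (exists_coprime_lt_iff (P := fun x y z =>
    X ∈ box x y z ∨ X ∈ box x z y ∨ X ∈ box z x y)).trans ?_
  simp only [box_eq_Icc, Set.mem_union, mem_family₁_iff, mem_family₂_iff, mem_family₃_iff]
  constructor
  · rintro ⟨p, q, hp, hq, hc, h | h | h⟩
    · exact ⟨_, .inl (.inl ⟨p, q, hp, hq, hc, rfl⟩), h⟩
    · exact ⟨_, .inl (.inr ⟨p, q, hp, hq, hc, rfl⟩), h⟩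
    · exact ⟨_, .inr ⟨p, q, hp, hq, hc, rfl⟩, h⟩
  · rintro ⟨_, (⟨p, q, hp, hq, hc, rfl⟩ | ⟨p, q, hp, hq, hc, rfl⟩) | ⟨p, q, hp, hq, hc, rfl⟩, h⟩
    · exact ⟨p, q, hp, hq, hc, .inl h⟩
    · exact ⟨p, q, hp, hq, hc, .inr (.inl h)⟩
    · exact ⟨p, q, hp, hq, hc, .inr (.inr h)⟩

/-! ### The corners form an antichain -/

/-- Clearing denominators gives `p * s ≤ r * q` and the reverse inequality, so both pairs are
reduced forms of the same ratio. -/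
theorem eq_of_coprime_of_div_le {p q r s : ℕ} (hp : 0 < p) (hr : 0 < r)
    (hpq : p.Coprime q) (hrs : r.Coprime s)
    (h₁ : (p : ℝ) / (p + q) ≤ (r : ℝ) / (r + s)) (h₂ : (q : ℝ) / (p + q) ≤ (s : ℝ) / (r + s)) :
    p = r ∧ q = s := by
  have hp' : (0 : ℝ) < p := by exact_mod_cast hp
  have hr' : (0 : ℝ) < r := by exact_mod_cast hr
  rw [div_le_div_iff₀ (by positivity) (by positivity)] at h₁ h₂
  have h : p * s = r * q := by
    have : (p : ℝ) * s = r * q := by linarith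
    exact_mod_cast this
  have hdvd : p ∣ r := hpq.dvd_of_dvd_mul_right ⟨s, h.symm⟩
  have hdvd' : r ∣ p := hrs.dvd_of_dvd_mul_right ⟨q, h⟩
  obtain rfl := Nat.dvd_antisymm hdvd hdvd'
  exact ⟨rfl, (Nat.eq_of_mul_eq_mul_left hp h).symm⟩

/-- Adding the inequalities yields `1 ≤ (r + 1)/(r + s)`, so `s = 1`; then `1/(r + s)` is `s/(r +
s)` and the previous lemma applies. -/
theorem eq_of_coprime_of_div_le_one_div {p q r s : ℕ} (hp : 0 < p) (hr : 0 < r) (hs : 0 < s)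
    (hpq : p.Coprime q)
    (h₁ : (p : ℝ) / (p + q) ≤ (r : ℝ) / (r + s)) (h₂ : (q : ℝ) / (p + q) ≤ 1 / ((r : ℝ) + s)) :
    p = r ∧ q = 1 ∧ s = 1 := by
  have hp' : (0 : ℝ) < p := by exact_mod_cast hp
  have hr' : (0 : ℝ) < r := by exact_mod_cast hr
  have hs₁ : s = 1 := by
    have hsum : (p : ℝ) / (p + q) + q / (p + q) = 1 := by field_simp
    have h : 1 ≤ ((r : ℝ) + 1) / (r + s) := by rw [add_div]; linarith
    rw [one_le_div (by positivity)] at h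
    have : s ≤ 1 := by exact_mod_cast (by linarith : (s : ℝ) ≤ 1)
    omega
  subst hs₁
  obtain ⟨rfl, rfl⟩ := eq_of_coprime_of_div_le hp hr hpq (Nat.coprime_one_right r) h₁
    (by simpa using h₂)
  exact ⟨rfl, rfl, rfl⟩

theorem corner_nonneg {X : ℝ × ℝ × ℝ} (hX : X ∈ family₁ ∪ family₂ ∪ family₃) : 0 ≤ X := by
  simp only [Set.mem_union, mem_family₁_iff, mem_family₂_iff, mem_family₃_iff] at hX
  obtain (⟨p, q, -, -, -, rfl⟩ | ⟨p, q, -, -, -, rfl⟩) | ⟨p, q, -, -, -, rfl⟩ := hX <;>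
    refine ⟨?_, ?_, ?_⟩ <;> simp only [Prod.fst_zero, Prod.snd_zero] <;> positivity

theorem corner_eq_of_le {X Y : ℝ × ℝ × ℝ} (hX : X ∈ family₁ ∪ family₂ ∪ family₃)
    (hY : Y ∈ family₁ ∪ family₂ ∪ family₃) (h : X ≤ Y) : X = Y := by
  simp only [Set.mem_union, mem_family₁_iff, mem_family₂_iff, mem_family₃_iff] at hX hY
  obtain (⟨p, q, hp, hq, hc, rfl⟩ | ⟨p, q, hp, hq, hc, rfl⟩) | ⟨p, q, hp, hq, hc, rfl⟩ := hX <;>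
  obtain (⟨r, s, hr, hs, hd, rfl⟩ | ⟨r, s, hr, hs, hd, rfl⟩) | ⟨r, s, hr, hs, hd, rfl⟩ := hY <;>
  obtain ⟨h₁, h₂, h₃⟩ := h <;> dsimp only at h₁ h₂ h₃
  -- Each case compares the two coordinates of `X` that sum to 1; the `add_comm` rewrites swap the
  -- roles of the two numerators.
  · obtain ⟨rfl, rfl⟩ := eq_of_coprime_of_div_le hp hr hc hd h₁ h₂
    rfl
  · obtain ⟨rfl, rfl, rfl⟩ := eq_of_coprime_of_div_le_one_div hp hr hs hc h₁ h₂
    simp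
  · rw [add_comm (p : ℝ)] at h₁ h₂
    obtain ⟨rfl, rfl, rfl⟩ := eq_of_coprime_of_div_le_one_div hq hr hs hc.symm h₂ h₁
    simp [add_comm]
  · obtain ⟨rfl, rfl, rfl⟩ := eq_of_coprime_of_div_le_one_div hp hr hs hc h₁ h₃
    simp
  · obtain ⟨rfl, rfl⟩ := eq_of_coprime_of_div_le hp hr hc hd h₁ h₃
    rfl
  · rw [add_comm (p : ℝ), add_comm (r : ℝ)] at h₁ h₃
    obtain ⟨rfl, rfl, rfl⟩ := eq_of_coprime_of_div_le_one_div hq hs hr hc.symm h₃ h₁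
    simp
  · rw [add_comm (r : ℝ)] at h₂ h₃
    obtain ⟨rfl, rfl, rfl⟩ := eq_of_coprime_of_div_le_one_div hp hs hr hc h₂ h₃
    simp [add_comm]
  · rw [add_comm (p : ℝ), add_comm (r : ℝ)] at h₂ h₃
    obtain ⟨rfl, rfl, rfl⟩ := eq_of_coprime_of_div_le_one_div hq hs hr hc.symm h₃ h₂
    simp
  · obtain ⟨rfl, rfl⟩ := eq_of_coprime_of_div_le hp hr hc hd h₂ h₃
    rfl

/-! ### Triangles, planes and the common point -/

theorem mem_triangle {P Q R : ℝ × ℝ × ℝ} {α β γ : ℝ} (hα : 0 ≤ α) (hβ : 0 ≤ β) (hγ : 0 ≤ γ)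
    (h : α + β + γ = 1) : α • P + β • Q + γ • R ∈ triangle P Q R := by
  have hsub := subset_convexHull ℝ ({P, Q, R} : Set (ℝ × ℝ × ℝ))
  have := (convex_convexHull ℝ ({P, Q, R} : Set (ℝ × ℝ × ℝ))).sum_mem
    (t := Finset.univ) (w := ![α, β, γ]) (z := ![P, Q, R])
    (by intro i _; fin_cases i <;> assumption) (by simpa [Fin.sum_univ_three] using h)
    (by intro i _; fin_cases i <;> exact hsub (by simp))
  simpa [triangle, Fin.sum_univ_three] using this

/-- These are the barycentric coordinates of a corner: only `ptD` contributes to the coordinate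
`1/(p+q)`, and it contributes half its weight, so that weight is `2/(p+q)`. -/
theorem barycentric_mem_triangle {p q : ℕ} (hp : 0 < p) (hq : 0 < q) (P Q R : ℝ × ℝ × ℝ) :
    (((p : ℝ) - 1) / (p + q)) • P + (((q : ℝ) - 1) / (p + q)) • Q + (2 / ((p : ℝ) + q)) • R ∈
      triangle P Q R := by
  have hp' : (1 : ℝ) ≤ p := by exact_mod_cast hp
  have hq' : (1 : ℝ) ≤ q := by exact_mod_cast hq
  apply mem_triangle
  · exact div_nonneg (by linarith) (by linarith)
  · exact div_nonneg (by linarith) (by linarith)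
  · positivity
  · have : (p : ℝ) + q ≠ 0 := by positivity
    field_simp
    ring

theorem family₁_subset_triangle : family₁ ⊆ triangle ptA ptB ptD := by
  intro X hX
  obtain ⟨p, q, hp, hq, -, rfl⟩ := mem_family₁_iff.1 hX
  convert barycentric_mem_triangle hp hq ptA ptB ptD using 1
  ext <;> simp [ptA, ptB, ptD] <;> ring

theorem family₂_subset_triangle : family₂ ⊆ triangle ptA ptC ptD := by
  intro X hX
  obtain ⟨p, q, hp, hq, -, rfl⟩ := mem_family₂_iff.1 hX
  convert barycentric_mem_triangle hp hq ptA ptC ptD using 1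
  ext <;> simp [ptA, ptC, ptD] <;> ring

theorem family₃_subset_triangle : family₃ ⊆ triangle ptB ptC ptD := by
  intro X hX
  obtain ⟨p, q, hp, hq, -, rfl⟩ := mem_family₃_iff.1 hX
  convert barycentric_mem_triangle hp hq ptB ptC ptD using 1
  ext <;> simp [ptB, ptC, ptD] <;> ring

theorem fst_add_snd_eq_one {X : ℝ × ℝ × ℝ} (hX : X ∈ family₁) : X.1 + X.2.1 = 1 := by
  obtain ⟨p, q, hp, hq, -, rfl⟩ := mem_family₁_iff.1 hX
  simp only
  field_simp

theorem fst_add_thd_eq_one {X : ℝ × ℝ × ℝ} (hX : X ∈ family₂) : X.1 + X.2.2 = 1 := by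
  obtain ⟨p, q, hp, hq, -, rfl⟩ := mem_family₂_iff.1 hX
  simp only
  field_simp

theorem snd_add_thd_eq_one {X : ℝ × ℝ × ℝ} (hX : X ∈ family₃) : X.2.1 + X.2.2 = 1 := by
  obtain ⟨p, q, hp, hq, -, rfl⟩ := mem_family₃_iff.1 hX
  simp only
  field_simp

theorem family₂_eq_image : family₂ = (fun X : ℝ × ℝ × ℝ => (X.2.1, X.2.2, X.1)) '' family₁ := by
  ext X
  constructor
  · rintro ⟨a, m, ha, hm, hc, rfl⟩
    exact ⟨_, ⟨a, m, ha, hm, hc, rfl⟩, rfl⟩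
  · rintro ⟨_, ⟨a, m, ha, hm, hc, rfl⟩, rfl⟩
    exact ⟨a, m, ha, hm, hc, rfl⟩

theorem family₃_eq_image : family₃ = (fun X : ℝ × ℝ × ℝ => (X.2.2, X.2.1, X.1)) '' family₁ := by
  ext X
  constructor
  · rintro ⟨a, m, ha, hm, hc, rfl⟩
    exact ⟨_, ⟨a, m, ha, hm, hc, rfl⟩, rfl⟩
  · rintro ⟨_, ⟨a, m, ha, hm, hc, rfl⟩, rfl⟩
    exact ⟨a, m, ha, hm, hc, rfl⟩

theorem inter_families : family₁ ∩ family₂ ∩ family₃ = {ptD} := by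
  ext X
  rw [Set.mem_singleton_iff]
  constructor
  · rintro ⟨⟨h₁, h₂⟩, h₃⟩
    have e₁ := fst_add_snd_eq_one h₁
    have e₂ := fst_add_thd_eq_one h₂
    have e₃ := snd_add_thd_eq_one h₃
    -- The three planes meet in a single point.
    ext <;> simp only [ptD] <;> linarith
  · rintro rfl
    refine ⟨⟨?_, ?_⟩, ?_⟩ <;> refine ⟨1, 2, by norm_num, by norm_num, by norm_num, ?_⟩ <;>
      norm_num [ptD]

end JankinsNeumann

theorem proposition2 :
    -- the vertices are exactly the points of the three families
    {X | JankinsNeumann.IsVertex JankinsNeumann.ziggurat X} =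
        JankinsNeumann.family₁ ∪ JankinsNeumann.family₂ ∪ JankinsNeumann.family₃ ∧
    -- the families differ by permutations of the coordinates
    JankinsNeumann.family₂ =
        (fun X : ℝ × ℝ × ℝ => (X.2.1, X.2.2, X.1)) '' JankinsNeumann.family₁ ∧
    JankinsNeumann.family₃ =
        (fun X : ℝ × ℝ × ℝ => (X.2.2, X.2.1, X.1)) '' JankinsNeumann.family₁ ∧
    -- they lie on the three planes
    (∀ X ∈ JankinsNeumann.family₁, X.1 + X.2.1 = 1) ∧
    (∀ X ∈ JankinsNeumann.family₂, X.1 + X.2.2 = 1) ∧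
    (∀ X ∈ JankinsNeumann.family₃, X.2.1 + X.2.2 = 1) ∧
    -- and in the three triangles
    JankinsNeumann.family₁ ⊆
        JankinsNeumann.triangle JankinsNeumann.ptA JankinsNeumann.ptB JankinsNeumann.ptD ∧
    JankinsNeumann.family₂ ⊆
        JankinsNeumann.triangle JankinsNeumann.ptA JankinsNeumann.ptC JankinsNeumann.ptD ∧
    JankinsNeumann.family₃ ⊆
        JankinsNeumann.triangle JankinsNeumann.ptB JankinsNeumann.ptC JankinsNeumann.ptD ∧
    -- `D` is the only point common to all three families
    JankinsNeumann.family₁ ∩ JankinsNeumann.family₂ ∩ JankinsNeumann.family₃ =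
        {JankinsNeumann.ptD} :=
  ⟨JankinsNeumann.setOf_isVertex_eq JankinsNeumann.mem_ziggurat_iff
      (fun _ => JankinsNeumann.corner_nonneg)
      (fun _ hX _ hY => JankinsNeumann.corner_eq_of_le hX hY),
    JankinsNeumann.family₂_eq_image, JankinsNeumann.family₃_eq_image,
    fun _ => JankinsNeumann.fst_add_snd_eq_one, fun _ => JankinsNeumann.fst_add_thd_eq_one,
    fun _ => JankinsNeumann.snd_add_thd_eq_one,
    JankinsNeumann.family₁_subset_triangle, JankinsNeumann.family₂_subset_triangle,
    JankinsNeumann.family₃_subset_triangle, JankinsNeumann.inter_families⟩
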